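/- **Setting.** Let $X\subset\mathbb{R}^d$ be compact and connected with $\mu(X)>0$, where $\mu$ is Lebesgue measure, and let $P$ be a probability measure with a bounded $\mu$-density $f\ge 0$ whose support is $X$. For $\rho\in\mathbb{R}$ let $M_\rho$ be the support of the measure $A\mapsto\mu(A\cap\{x\in X: f(x)\ge\rho\})$. $P$ is *normal* if for all $\rho\ge 0$ the sets $\bigcup_{\rho'>\rho}M_{\rho'}$ and $\bigcup_{\rho'>\rho}\mathring M_{\rho'}$ (interior relative to $X$) agree up to a $\mu$-null set. $\mathcal{C}(A)$ denotes the set of connected components of $A$. $\mathcal{C}_\tau(A)$ denotes the set of $\tau$-connected components of $A$, where two points of $A$ are $\tau$-connected in $A$ if they are joined by a finite chain in $A$ with consecutive Euclidean distances $<\tau$. For $A\subset X$ put $A^{+\delta}=\{x\in X: d(x,A)\le\delta\}$, $A^{-\delta}=X\setminus(X\setminus A)^{+\delta}$ and $\psi_A^*(\delta)=\sup_{x\in A}d(x,A^{-\delta})$, with $d(x,\emptyset)=\infty$. **Assumption 1.** There are $0\le\rho^*<\rho^{**}$ such that $P$ *can be clustered* between $\rho^*$ and $\rho^{**}$: $P$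 is normal and for all $\rho\in[0,\rho^{**}]$, $|\mathcal{C}(M_\rho)|\in\{1,2\}$; if $|\mathcal{C}(M_\rho)|=1$ then $\rho\le\rho^*$; if $|\mathcal{C}(M_\rho)|=2$ then $\rho\ge\rho^*$, and every component of $M_{\rho^{**}}$ is contained in a component of $M_\rho$, the resulting map $\zeta_\rho:\mathcal{C}(M_{\rho^{**}})\to\mathcal{C}(M_\rho)$ being a bijection. Moreover $P$ has *thick level sets*: there are $\gamma\in(0,1]$, $c_{\rm thick}\ge1$, $\delta_{\rm thick}\in(0,1]$ with $\psi^*_{M_\rho}(\delta)\le c_{\rm thick}\delta^\gamma$ for all $\delta\in(0,\delta_{\rm thick}]$ and $\rho\in[0,\rho^{**}]$. Put $\psi(\delta)=3c_{\rm thick}\delta^\gamma$. With $A_1,A_2$ the two components of $M_{\rho^{**}}$, the clusters are $A_i^*=\bigcup_{\rho\in(\rho^*,\rho^{**}]}\zeta_\rho(A_i)$, and $\tau^*(\varepsilon)=\tfrac13\,d(\zeta_{\rho^*+\varepsilon}(A_1),\zeta_{\rho^*+\varepsilon}(A_2))$ for $\varepsilon\in(0,\rho^{**}-\rho^*]$.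 **Assumption 2.** $P$ is normal and there are $\rho_*\ge0$, $\gamma\in(0,1]$, $c_{\rm thick}\ge1$, $\delta_{\rm thick}\in(0,1]$ such that for all $\rho\ge\rho_*$ and $\delta\in(0,\delta_{\rm thick}]$: $|\mathcal{C}(M_\rho)|\le1$; if $M_\rho^{-\delta}\ne\emptyset$ then $\psi^*_{M_\rho}(\delta)\le c_{\rm thick}\delta^\gamma$; if $M_\rho^{-\delta}=\emptyset$ then $|\mathcal{C}_\tau(A)|=1$ for every non-empty $A\subset M_\rho^{+\delta}$ and every $\tau>2c_{\rm thick}\delta^\gamma$; and for each $\delta\in(0,\delta_{\rm thick}]$ there is $\rho\ge\rho_*$ with $M_\rho^{-\delta}=\emptyset$. **Algorithm 1.** Input: $\tau,\varepsilon>0$, a start level $\rho_0\ge0$ and a decreasing family $(L_\rho)_{\rho\ge0}$ of subsets of $X$. For a level $\rho$ let $B_1',\dots,B_M'$ be the $\tau$-connected components of $L_\rho$ that intersect $L_{\rho+2\varepsilon}$. Set $\rho=\rho_0$; repeat {determine $M$ at level $\rho$; then $\rho\leftarrow\rho+\varepsilon$} until $M\ne1$; set $\rho\leftarrow\rho+2\varepsilon$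 and determine $B_1',\dots,B'_M$ at the new level $\rho$. If $M>1$, return $\rho_{\rm out}=\rho$ and the sets $B_1',\dots,B_M'$; otherwise return $\rho_{\rm out}=\rho_0$ and the single set $L_{\rho_0}$. **Theorem.** (i) Let Assumption 1 hold, let $\varepsilon^*\le(\rho^{**}-\rho^*)/9$, $\varepsilon\in(0,\varepsilon^*]$, $\delta\in(0,\delta_{\rm thick}]$, $\tau\in(\psi(\delta),\tau^*(\varepsilon^*)]$ and $0\le\rho_0\le\rho^*+\varepsilon^*+2\varepsilon$, and let $(L_\rho)_{\rho\ge0}$ be a decreasing family of subsets of $X$ with $M_{\rho+\varepsilon}^{-\delta}\subset L_\rho\subset M_{\rho-\varepsilon}^{+\delta}$ for all $\rho\ge\rho_0$. Then Algorithm 1 terminates, and: (a) the returned level satisfies $\rho_{\rm out}\in[\rho^*+2\varepsilon,\ \rho^*+\varepsilon^*+5\varepsilon]$ and $\tau-\psi(\delta)<3\tau^*(\rho_{\rm out}-\rho^*+\varepsilon)$; (b) exactly two sets are returned, and they can be ordered as $B_1,B_2$ such that $$\sum_{i=1}^2\mu(B_i\triangle A_i^*)\le2\sum_{i=1}^2\mu\bigl(A_i^*\setminus(A^i_{\rho_{\rm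 out}+\varepsilon})^{-\delta}\bigr)+\mu\bigl(M_{\rho_{\rm out}-\varepsilon}^{+\delta}\setminus\{f>\rho^*\}\bigr),$$ where $A^1_{\rho_{\rm out}+\varepsilon},A^2_{\rho_{\rm out}+\varepsilon}$ are the two components of $M_{\rho_{\rm out}+\varepsilon}$, ordered such that $A^i_{\rho_{\rm out}+\varepsilon}\subset A_i^*$. (ii) Let Assumption 2 hold, let $\varepsilon>0$, $\delta\in(0,\delta_{\rm thick}]$, $\tau>2c_{\rm thick}\delta^\gamma$, $\rho_0\ge\rho_*$, and let $(L_\rho)_{\rho\ge0}$ be a decreasing family of subsets of $X$ with $M_{\rho+\varepsilon}^{-\delta}\subset L_\rho\subset M_{\rho-\varepsilon}^{+\delta}$ for all $\rho\ge\rho_0$. Then Algorithm 1 terminates and returns the start level $\rho_0$ and the single set $L_{\rho_0}$, and with $\widehat M_{\rho_*}=\bigcup_{\rho>\rho_*}M_\rho$, $$\mu(L_{\rho_0}\triangle\widehat M_{\rho_*})\le\mu\bigl(M_{\rho_0-\varepsilon}^{+\delta}\setminus\widehat M_{\rho_*}\bigr)+\mu\bigl(\widehat M_{\rho_*}\setminus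 M_{\rho_0+\varepsilon}^{-\delta}\bigr).$$ If some $L_\rho$ is not measurable, $\mu$ of a non-measurable set means Lebesgue outer measure. -/

import Mathlib

open MeasureTheory Set Topology
open scoped ENNReal

noncomputable section

namespace LevelSetClustering

/-- Euclidean space `ℝᵈ`. -/
abbrev E (d : ℕ) : Type := EuclideanSpace ℝ (Fin d)

variable {d : ℕ}

/-! ### Distributions and density level sets -/

/-- The standing assumptions: `X ⊆ ℝᵈ` is compact and connected with positive Lebesgue measure,
and `P` is a probability measure with a bounded Lebesgue density `f` whose support is `X`. -/
structure HasBoundedDensity (X : Set (E d)) (P : Measure (E d)) (f : E d → ℝ) : Prop where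
  isCompact : IsCompact X
  isConnected : IsConnected X
  volume_pos : 0 < volume X
  isProbabilityMeasure : IsProbabilityMeasure P
  measurable : Measurable f
  nonneg : ∀ x, 0 ≤ f x
  bounded : ∃ C : ℝ, ∀ x, f x ≤ C
  support_eq : tsupport f = X
  density : P = volume.withDensity (fun x => ENNReal.ofReal (f x))

/-- The level set `M_ρ`: the support of the measure `A ↦ μ (A ∩ {f ≥ ρ})` on `X`. The formula is
used for all real `ρ`. -/
def levelSet (X : Set (E d)) (f : E d → ℝ) (ρ : ℝ) : Set (E d) :=
  (volume.restrict {x | x ∈ X ∧ ρ ≤ f x}).support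

/-- `⋃_{ρ' > ρ} M_{ρ'}`. -/
def upperLevelSet (X : Set (E d)) (f : E d → ℝ) (ρ : ℝ) : Set (E d) :=
  ⋃ ρ' ∈ Ioi ρ, levelSet X f ρ'

/-- The interior of `A ⊆ X` in the space `X`. -/
def interiorIn (X A : Set (E d)) : Set (E d) := {x | x ∈ X ∧ A ∈ 𝓝[X] x}

/-- Normality: `⋃_{ρ' > ρ} M_{ρ'}` and `⋃_{ρ' > ρ} int M_{ρ'}` agree up to a Lebesgue null set, at
every level `ρ ≥ 0`. (The second set is always contained in the first. Equality of the two sets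
is a special case.) -/
def IsNormal (X : Set (E d)) (f : E d → ℝ) : Prop :=
  ∀ ρ : ℝ, 0 ≤ ρ →
    volume (upperLevelSet X f ρ \ ⋃ ρ' ∈ Ioi ρ, interiorIn X (levelSet X f ρ')) = 0

/-! ### Components, comparable partitions and cell relating maps -/

/-- The set `𝒞(A)` of topologically connected components of `A`. -/
def components (A : Set (E d)) : Set (Set (E d)) := connectedComponentIn A '' A

/-- `x` and `y` are `τ`-connected in `A`: they are joined by a chain of points of `A` with
consecutive distances less than `τ`. -/
def TauConnected (τ : ℝ) (A : Set (E d)) (x y : E d) : Prop :=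
  x ∈ A ∧ y ∈ A ∧ Relation.ReflTransGen (fun u v => u ∈ A ∧ v ∈ A ∧ dist u v < τ) x y

/-- The set `𝒞_τ(A)` of `τ`-connected components of `A`. -/
def tauComponents (τ : ℝ) (A : Set (E d)) : Set (Set (E d)) :=
  (fun x => {y | TauConnected τ A x y}) '' A

/-- `ζ` is a cell relating map from the partition `𝒜` to the partition `ℬ`. -/
def IsCRM (𝒜 ℬ : Set (Set (E d))) (ζ : Set (E d) → Set (E d)) : Prop :=
  ∀ A' ∈ 𝒜, ζ A' ∈ ℬ ∧ A' ⊆ ζ A'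

/-- `𝒜` is comparable to `ℬ` and the cells of `ℬ` correspond one-to-one to those of `𝒜`: the cell
relating map is a bijection. -/
def Persistent (𝒜 ℬ : Set (Set (E d))) : Prop :=
  ∃ ζ : Set (E d) → Set (E d), IsCRM 𝒜 ℬ ζ ∧ BijOn ζ 𝒜 ℬ

/-- The value of the cell relating map into the partition `ℬ` at the cell `A'`: the cell of `ℬ`
that contains `A'` (see `crm_eq`). -/
def crm (ℬ : Set (Set (E d))) (A' : Set (E d)) : Set (E d) := ⋃₀ {B' | B' ∈ ℬ ∧ A' ⊆ B'}

theorem crm_eq {ℬ : Set (Set (E d))} (hℬ : ℬ.PairwiseDisjoint id) {A' B' : Set (E d)}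
    (hA' : A'.Nonempty) (hB' : B' ∈ ℬ) (h : A' ⊆ B') : crm ℬ A' = B' := by
  apply Subset.antisymm
  · rintro x ⟨C, ⟨hC, hAC⟩, hx⟩
    obtain ⟨a, ha⟩ := hA'
    have : C = B' := hℬ.elim_set hC hB' a (hAC ha) (h ha)
    exact this ▸ hx
  · exact subset_sUnion_of_mem ⟨hB', h⟩

/-! ### Clusters -/

/-- The distribution with density `f` can be clustered between `ρs` (`ρ^*`) and `ρss`
(`ρ^{**}`). -/
structure CanBeClustered (X : Set (E d)) (f : E d → ℝ) (ρs ρss : ℝ) : Prop where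
  nonneg : 0 ≤ ρs
  lt : ρs < ρss
  normal : IsNormal X f
  one_or_two : ∀ ρ ∈ Icc 0 ρss,
    (components (levelSet X f ρ)).encard = 1 ∨ (components (levelSet X f ρ)).encard = 2
  of_one : ∀ ρ ∈ Icc 0 ρss, (components (levelSet X f ρ)).encard = 1 → ρ ≤ ρs
  of_two : ∀ ρ ∈ Icc 0 ρss, (components (levelSet X f ρ)).encard = 2 →
    ρs ≤ ρ ∧ Persistent (components (levelSet X f ρss)) (components (levelSet X f ρ))

/-- `A 0, A 1` list, without repetition, the members of the family `𝒜` (which therefore has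
exactly two members). -/
def Enumerates (A : Fin 2 → Set (E d)) (𝒜 : Set (Set (E d))) : Prop :=
  Function.Injective A ∧ range A = 𝒜

/-- The component `ζ_ρ(A i)` of `M_ρ` containing the component `A i` of `M_{ρ^{**}}`. -/
def levelComponent (X : Set (E d)) (f : E d → ℝ) (A : Fin 2 → Set (E d)) (ρ : ℝ) (i : Fin 2) :
    Set (E d) :=
  crm (components (levelSet X f ρ)) (A i)

/-- The cluster `A_i^* = ⋃_{ρ ∈ (ρ^*, ρ^{**}]} ζ_ρ(A i)`. -/
def cluster (X : Set (E d)) (f : E d → ℝ) (A : Fin 2 → Set (E d)) (ρs ρss : ℝ) (i : Fin 2) :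
    Set (E d) :=
  ⋃ ρ ∈ Ioc ρs ρss, levelComponent X f A ρ i

/-- The distance `inf {‖a - b‖ : a ∈ A, b ∈ B}` of two (nonempty) sets. -/
def setDist (A B : Set (E d)) : ℝ := sInf (image2 dist A B)

/-- `τ^*(ε) = d(ζ_{ρ^*+ε}(A 0), ζ_{ρ^*+ε}(A 1)) / 3`. -/
def tauStar (X : Set (E d)) (f : E d → ℝ) (A : Fin 2 → Set (E d)) (ρs ε : ℝ) : ℝ :=
  (1 / 3) * setDist (levelComponent X f A (ρs + ε) 0) (levelComponent X f A (ρs + ε) 1)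

/-! ### Tubes and thickness -/

/-- `A^{+δ} = {x ∈ X : d(x, A) ≤ δ}`, with `d(x, ∅) = ∞`. -/
def addTube (X : Set (E d)) (δ : ℝ) (A : Set (E d)) : Set (E d) :=
  {x | x ∈ X ∧ Metric.infEDist x A ≤ ENNReal.ofReal δ}

/-- `A^{-δ} = X \ (X \ A)^{+δ}`. -/
def subTube (X : Set (E d)) (δ : ℝ) (A : Set (E d)) : Set (E d) :=
  X \ addTube X δ (X \ A)

/-- `ψ_A^*(δ) = sup_{x ∈ A} d(x, A^{-δ})`, which is `∞` if `A ≠ ∅` and `A^{-δ} = ∅`. -/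
def psiStar (X A : Set (E d)) (δ : ℝ) : ℝ≥0∞ :=
  ⨆ x ∈ A, Metric.infEDist x (subTube X δ A)

/-- Thick level sets of order `γ` up to the level `ρss`, with constants `c` and `δt`
(`c_thick` and `δ_thick`). -/
structure HasThickLevelSets (X : Set (E d)) (f : E d → ℝ) (γ ρss c δt : ℝ) : Prop where
  normal : IsNormal X f
  level_pos : 0 < ρss
  order_mem : γ ∈ Ioc (0 : ℝ) 1
  one_le : 1 ≤ c
  delta_mem : δt ∈ Ioc (0 : ℝ) 1
  thick : ∀ δ ∈ Ioc 0 δt, ∀ ρ ∈ Icc 0 ρss,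
    psiStar X (levelSet X f ρ) δ ≤ ENNReal.ofReal (c * δ ^ γ)

/-- The thickness function `ψ(δ) = 3 c_thick δ^γ`. -/
def thickness (c γ δ : ℝ) : ℝ := 3 * c * δ ^ γ

/-! ### The two assumptions on the distribution -/

/-- The case of two clusters. -/
structure TwoClusterAssumption (X : Set (E d)) (P : Measure (E d)) (f : E d → ℝ)
    (ρs ρss γ c δt : ℝ) : Prop where
  density : HasBoundedDensity X P f
  clustered : CanBeClustered X f ρs ρss
  thick : HasThickLevelSets X f γ ρss c δt

/-- The case of a single cluster; `ρl` is the level `ρ_*`. -/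
structure OneClusterAssumption (X : Set (E d)) (P : Measure (E d)) (f : E d → ℝ)
    (ρl γ c δt : ℝ) : Prop where
  density : HasBoundedDensity X P f
  normal : IsNormal X f
  level_nonneg : 0 ≤ ρl
  order_mem : γ ∈ Ioc (0 : ℝ) 1
  one_le : 1 ≤ c
  delta_mem : δt ∈ Ioc (0 : ℝ) 1
  connected : ∀ ρ, ρl ≤ ρ → (components (levelSet X f ρ)).encard ≤ 1
  thick : ∀ ρ, ρl ≤ ρ → ∀ δ ∈ Ioc 0 δt, (subTube X δ (levelSet X f ρ)).Nonempty →
    psiStar X (levelSet X f ρ) δ ≤ ENNReal.ofReal (c * δ ^ γ)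
  tube_connected : ∀ ρ, ρl ≤ ρ → ∀ δ ∈ Ioc 0 δt, subTube X δ (levelSet X f ρ) = ∅ →
    ∀ A : Set (E d), A.Nonempty → A ⊆ addTube X δ (levelSet X f ρ) →
      ∀ τ : ℝ, 2 * c * δ ^ γ < τ → (tauComponents τ A).encard = 1
  vanish : ∀ δ ∈ Ioc 0 δt, ∃ ρ, ρl ≤ ρ ∧ subTube X δ (levelSet X f ρ) = ∅

/-! ### Level set estimators and the algorithm -/

/-- `(L_ρ)_{ρ ≥ 0}` is a decreasing family of subsets of `X`. Only the values at `ρ ≥ 0`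
matter. -/
structure IsDecreasingFamily (X : Set (E d)) (L : ℝ → Set (E d)) : Prop where
  subset : ∀ ρ, 0 ≤ ρ → L ρ ⊆ X
  antitone : AntitoneOn L (Ici 0)

/-- `M_{ρ+ε}^{-δ} ⊆ L_ρ ⊆ M_{ρ-ε}^{+δ}` for all `ρ ≥ ρ₀`. -/
def UncertaintyControl (X : Set (E d)) (f : E d → ℝ) (ε δ ρ₀ : ℝ) (L : ℝ → Set (E d)) : Prop :=
  ∀ ρ, ρ₀ ≤ ρ → subTube X δ (levelSet X f (ρ + ε)) ⊆ L ρ ∧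
    L ρ ⊆ addTube X δ (levelSet X f (ρ - ε))

/-- The `τ`-connected components of `L_ρ` that meet `L_{ρ+2ε}`, as identified by the algorithm. -/
def identified (τ ε : ℝ) (L : ℝ → Set (E d)) (ρ : ℝ) : Set (Set (E d)) :=
  {B | B ∈ tauComponents τ (L ρ) ∧ (B ∩ L (ρ + 2 * ε)).Nonempty}

/-- The loop `repeat {identify the components at level ρ; ρ ← ρ + ε} until M ≠ 1`, where `M` is the
number of identified components: `RepeatLoop τ ε L ρ ρ'` says that the loop, entered with the
value `ρ`, terminates with the value `ρ'`. -/
inductive RepeatLoop (τ ε : ℝ) (L : ℝ → Set (E d)) : ℝ → ℝ → Prop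
  | exit (ρ : ℝ) (h : (identified τ ε L ρ).encard ≠ 1) : RepeatLoop τ ε L ρ (ρ + ε)
  | again (ρ ρ' : ℝ) (h : (identified τ ε L ρ).encard = 1) (h' : RepeatLoop τ ε L (ρ + ε) ρ') :
      RepeatLoop τ ε L ρ ρ'

/-- `Returns τ ε ρ₀ L ρout ℬ`: the clustering algorithm, run with the parameters `τ`, `ε`, the start
level `ρ₀` and the family `L`, terminates and returns the level `ρout` and the sets in `ℬ`. After
the loop, `ρ` is increased by `2ε` and the components are identified once more; if there is more
than one, they are returned with the current level, otherwise `ρ₀` and the single set `L_{ρ₀}`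
are returned. -/
inductive Returns (τ ε ρ₀ : ℝ) (L : ℝ → Set (E d)) : ℝ → Set (Set (E d)) → Prop
  | several (ρ : ℝ) (hloop : RepeatLoop τ ε L ρ₀ ρ)
      (h : 1 < (identified τ ε L (ρ + 2 * ε)).encard) :
      Returns τ ε ρ₀ L (ρ + 2 * ε) (identified τ ε L (ρ + 2 * ε))
  | single (ρ : ℝ) (hloop : RepeatLoop τ ε L ρ₀ ρ)
      (h : ¬ 1 < (identified τ ε L (ρ + 2 * ε)).encard) :
      Returns τ ε ρ₀ L ρ₀ {L ρ₀}

end LevelSetClustering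

end

/-!
Everything rests on one topological observation. Suppose every point of a set `M` lies within
`τ / 2` of a set `N`. For a connected piece `S ⊆ M`, the balls of radius `τ / 2` around the points
of one `τ`-class of `N` and the balls around the remaining points of `N` are two open sets that
cover `S` and do not meet, since otherwise two points of different classes would have distance
less than `τ`. So all the points of `N` near `S` belong to one `τ`-class
(`tauConnected_of_isPreconnected`). Thickness supplies this covering with `M = M_ρ` and
`N = M_ρ^{-δ}`.

In the case of two clusters, choose points `a i` in the two components of `M_{ρ^{**}}` and points
`z i ∈ M_{ρ^{**}}^{-δ}` close to them. Up to the level `ρ^{**} - 3ε` the components identified by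
the algorithm at a level `ρ` are exactly the `τ`-classes of `z 0` and `z 1` in `L_ρ`
(`TwoClusterSetting.identified_eq`), so the algorithm only tests whether `z 0` and `z 1` are
`τ`-connected in `L_ρ`. Since `L` is decreasing, once they are separated they remain separated.
They are `τ`-connected while `M_{ρ+ε}` is connected, and separated as soon as
`ρ ≥ ρ^* + ε^* + ε`, because then `L_ρ` lies in two tubes at distance greater than `τ`. This
determines the range of the returned level. At that level, two points of the different components
of `M_{ρ+ε}` at distance at most `τ - ψ(δ)` would join `z 0` to `z 1`, which gives the bound on
`τ^*`.

For the measure estimate, `B i` contains `(A' i)^{-δ}` and is disjoint from the other returned set,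
while `{f > ρ^*}` is contained in the union of the clusters up to a null set. The returned sets
need not be measurable; outer measure is additive on them because they have distance at least `τ`.

In the case of a single cluster at most one component is identified at each level
(`encard_identified_le_one_of_oneCluster`), and none at levels beyond the bound on `f`.
-/

namespace LevelSetClustering

variable {d : ℕ}

/-! ### Chains and `τ`-components -/

theorem TauConnected.refl {τ : ℝ} {A : Set (E d)} {x : E d} (hx : x ∈ A) :
    TauConnected τ A x x := ⟨hx, hx, .refl⟩

theorem TauConnected.trans {τ : ℝ} {A : Set (E d)} {x y z : E d} (h : TauConnected τ A x y)
    (h' : TauConnected τ A y z) : TauConnected τ A x z := ⟨h.1, h'.2.1, h.2.2.trans h'.2.2⟩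

theorem TauConnected.symm {τ : ℝ} {A : Set (E d)} {x y : E d} (h : TauConnected τ A x y) :
    TauConnected τ A y x := by
  have : Std.Symm fun u v => u ∈ A ∧ v ∈ A ∧ dist u v < τ :=
    ⟨fun u v h => ⟨h.2.1, h.1, dist_comm u v ▸ h.2.2⟩⟩
  exact ⟨h.2.1, h.1, Relation.ReflTransGen.stdSymm.symm _ _ h.2.2⟩

theorem TauConnected.mono {τ : ℝ} {A B : Set (E d)} {x y : E d} (hAB : A ⊆ B)
    (h : TauConnected τ A x y) : TauConnected τ B x y :=
  ⟨hAB h.1, hAB h.2.1,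
    Relation.ReflTransGen.mono (fun _ _ h => ⟨hAB h.1, hAB h.2.1, h.2.2⟩) _ _ h.2.2⟩

theorem TauConnected.of_dist_lt {τ : ℝ} {A : Set (E d)} {x y : E d} (hx : x ∈ A) (hy : y ∈ A)
    (h : dist x y < τ) : TauConnected τ A x y := ⟨hx, hy, .single ⟨hx, hy, h⟩⟩

/-- The `τ`-class of `x` in `A`: the set of points of `A` that are `τ`-connected to `x`. -/
def tauClass (τ : ℝ) (A : Set (E d)) (x : E d) : Set (E d) := {y | TauConnected τ A x y}

theorem mem_tauClass_self {τ : ℝ} {A : Set (E d)} {x : E d} (hx : x ∈ A) :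
    x ∈ tauClass τ A x := TauConnected.refl hx

theorem tauClass_subset {τ : ℝ} {A : Set (E d)} {x : E d} : tauClass τ A x ⊆ A :=
  fun _ h => h.2.1

theorem TauConnected.tauClass_eq {τ : ℝ} {A : Set (E d)} {x y : E d} (h : TauConnected τ A x y) :
    tauClass τ A x = tauClass τ A y :=
  Subset.antisymm (fun _ hz => h.symm.trans hz) (fun _ hz => h.trans hz)

theorem tauClass_mem_tauComponents {τ : ℝ} {A : Set (E d)} {x : E d} (hx : x ∈ A) :
    tauClass τ A x ∈ tauComponents τ A := ⟨x, hx, rfl⟩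

theorem eq_tauClass_of_mem {τ : ℝ} {A B : Set (E d)} (hB : B ∈ tauComponents τ A) {x : E d}
    (hx : x ∈ B) : B = tauClass τ A x := by
  obtain ⟨y, -, rfl⟩ := hB
  exact TauConnected.tauClass_eq hx

/-- If the `r`-balls around the points of `N` cover a connected set `S` and `2r ≤ τ`, then all the
points of `N` within distance `r` of `S` are in one `τ`-component of `N`. -/
theorem tauConnected_of_isPreconnected {τ r : ℝ} (hr : 2 * r ≤ τ) {S N : Set (E d)}
    (hS : IsPreconnected S) (hcov : ∀ x ∈ S, ∃ y ∈ N, dist x y < r) {x x' y y' : E d}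
    (hx : x ∈ S) (hx' : x' ∈ S) (hy : y ∈ N) (hy' : y' ∈ N) (h : dist x y < r)
    (h' : dist x' y' < r) : TauConnected τ N y y' := by
  by_contra hne
  set U : Set (E d) := ⋃ w ∈ tauClass τ N y, Metric.ball w r with hU
  set V : Set (E d) := ⋃ w ∈ N \ tauClass τ N y, Metric.ball w r with hV
  have hUo : IsOpen U := isOpen_biUnion fun _ _ => Metric.isOpen_ball
  have hVo : IsOpen V := isOpen_biUnion fun _ _ => Metric.isOpen_ball
  have hSUV : S ⊆ U ∪ V := by
    intro z hz
    obtain ⟨w, hw, hzw⟩ := hcov z hz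
    by_cases hc : w ∈ tauClass τ N y
    · exact Or.inl (mem_biUnion hc hzw)
    · exact Or.inr (mem_biUnion (show w ∈ N \ tauClass τ N y from ⟨hw, hc⟩) hzw)
  obtain ⟨z, -, hzU, hzV⟩ := hS U V hUo hVo hSUV
    ⟨x, hx, mem_biUnion (mem_tauClass_self hy) h⟩
    ⟨x', hx', mem_biUnion (show y' ∈ N \ tauClass τ N y from ⟨hy', hne⟩) h'⟩
  simp only [hU, hV, mem_iUnion, Metric.mem_ball] at hzU hzV
  obtain ⟨u, hu, hzu⟩ := hzU
  obtain ⟨v, ⟨hvN, hv⟩, hzv⟩ := hzV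
  refine hv (TauConnected.trans hu (.of_dist_lt hu.2.1 hvN ?_))
  have := dist_triangle_left u v z
  linarith

/-! ### Components, tubes and level sets -/

theorem pairwiseDisjoint_components (M : Set (E d)) : (components M).PairwiseDisjoint id := by
  rintro _ ⟨x, -, rfl⟩ _ ⟨y, -, rfl⟩ hne
  refine Set.disjoint_left.2 fun z hz hz' => hne ?_
  exact (connectedComponentIn_eq hz).trans (connectedComponentIn_eq hz').symm

theorem components_nonempty {M C : Set (E d)} (hC : C ∈ components M) : C.Nonempty := by
  obtain ⟨y, hy, rfl⟩ := hC
  exact ⟨y, mem_connectedComponentIn hy⟩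

theorem components_subset {M C : Set (E d)} (hC : C ∈ components M) : C ⊆ M := by
  obtain ⟨y, -, rfl⟩ := hC
  exact connectedComponentIn_subset M y

theorem components_isPreconnected {M C : Set (E d)} (hC : C ∈ components M) :
    IsPreconnected C := by
  obtain ⟨y, -, rfl⟩ := hC
  exact isPreconnected_connectedComponentIn

theorem isPreconnected_of_encard_components_le_one {M : Set (E d)}
    (h : (components M).encard ≤ 1) : IsPreconnected M := by
  refine isPreconnected_of_forall_pair fun x hx y hy => ?_
  refine ⟨connectedComponentIn M x, connectedComponentIn_subset M x,
    mem_connectedComponentIn hx, ?_, isPreconnected_connectedComponentIn⟩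
  rw [encard_le_one_iff.1 h _ _ (mem_image_of_mem _ hx) (mem_image_of_mem _ hy)]
  exact mem_connectedComponentIn hy

theorem subTube_subset {X A : Set (E d)} {δ : ℝ} : subTube X δ A ⊆ A := by
  rintro x ⟨hxX, hx⟩
  by_contra hxA
  have hmem : x ∈ X \ A := ⟨hxX, hxA⟩
  exact hx ⟨hxX, by simp [Metric.infEDist_zero_of_mem hmem]⟩

theorem addTube_mono {X A B : Set (E d)} {δ : ℝ} (h : A ⊆ B) : addTube X δ A ⊆ addTube X δ B :=
  fun _ hx => ⟨hx.1, (Metric.infEDist_anti h).trans hx.2⟩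

theorem subTube_mono {X A B : Set (E d)} {δ : ℝ} (h : A ⊆ B) : subTube X δ A ⊆ subTube X δ B :=
  sdiff_subset_sdiff_right (addTube_mono (sdiff_subset_sdiff_right h))

theorem exists_dist_lt_of_infEDist_le {A : Set (E d)} {x : E d} {t r : ℝ} (htr : t < r)
    (hr : 0 < r) (h : Metric.infEDist x A ≤ ENNReal.ofReal t) : ∃ y ∈ A, dist x y < r := by
  have hlt : Metric.infEDist x A < ENNReal.ofReal r :=
    h.trans_lt ((ENNReal.ofReal_lt_ofReal_iff hr).2 htr)
  obtain ⟨y, hy, hxy⟩ := Metric.infEDist_lt_iff.1 hlt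
  refine ⟨y, hy, ?_⟩
  rw [edist_dist] at hxy
  exact (ENNReal.ofReal_lt_ofReal_iff hr).1 hxy

theorem exists_dist_lt_of_mem_addTube {X A : Set (E d)} {x : E d} {δ r : ℝ} (hδr : δ < r)
    (hr : 0 < r) (h : x ∈ addTube X δ A) : ∃ y ∈ A, dist x y < r :=
  exists_dist_lt_of_infEDist_le hδr hr h.2

theorem exists_dist_lt_of_psiStar_le {X A : Set (E d)} {δ t r : ℝ} (htr : t < r) (hr : 0 < r)
    (h : psiStar X A δ ≤ ENNReal.ofReal t) : ∀ x ∈ A, ∃ y ∈ subTube X δ A, dist x y < r :=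
  fun x hx => exists_dist_lt_of_infEDist_le htr hr
    ((le_iSup₂ (f := fun x (_ : x ∈ A) => Metric.infEDist x (subTube X δ A)) x hx).trans h)

theorem addTube_empty {X : Set (E d)} {δ : ℝ} : addTube X δ ∅ = ∅ := by
  ext x
  simp [addTube]

theorem levelSet_antitone (X : Set (E d)) (f : E d → ℝ) : Antitone (levelSet X f) :=
  fun ρ ρ' h => Measure.support_mono <| Measure.restrict_mono
    (show {x | x ∈ X ∧ ρ' ≤ f x} ⊆ {x | x ∈ X ∧ ρ ≤ f x} from
      fun _ hx => ⟨hx.1, h.trans hx.2⟩) le_rfl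

theorem levelSet_eq_empty {X : Set (E d)} {f : E d → ℝ} {C ρ : ℝ} (hC : ∀ x, f x ≤ C)
    (h : C < ρ) : levelSet X f ρ = ∅ := by
  have : {x | x ∈ X ∧ ρ ≤ f x} = ∅ := by
    ext x
    simp only [mem_ofPred_eq, mem_empty_iff_false, iff_false, not_and, not_le]
    exact fun _ => (hC x).trans_lt h
  simp [levelSet, this]

theorem volume_superlevel_sdiff_levelSet (X : Set (E d)) (f : E d → ℝ) (ρ : ℝ) :
    volume ({x | x ∈ X ∧ ρ ≤ f x} \ levelSet X f ρ) = 0 := by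
  have h := Measure.measure_compl_support (μ := volume.restrict {x | x ∈ X ∧ ρ ≤ f x})
  rw [Measure.restrict_apply Measure.isOpen_compl_support.measurableSet] at h
  rw [sdiff_eq, inter_comm]
  exact h

theorem volume_strict_superlevel_sdiff_iUnion_levelSet (X : Set (E d)) (f : E d → ℝ) {a b : ℝ}
    (hab : a < b) : volume ({x | x ∈ X ∧ a < f x} \ ⋃ ρ ∈ Ioc a b, levelSet X f ρ) = 0 := by
  -- A sequence of levels in `(a, b]` that decreases to `a` exhausts the strict superlevel set.
  have hlev : ∀ n : ℕ, a + (b - a) / (n + 1) ∈ Ioc a b := fun n => by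
    have hn : (0 : ℝ) < n + 1 := by positivity
    have hba : 0 < b - a := sub_pos.2 hab
    refine ⟨lt_add_of_pos_right a (div_pos hba hn), ?_⟩
    have : (b - a) / (n + 1) ≤ b - a := div_le_self hba.le (by linarith [n.cast_nonneg (α := ℝ)])
    linarith
  refine measure_mono_null (t := ⋃ n : ℕ, {x | x ∈ X ∧ a + (b - a) / (n + 1) ≤ f x} \
    levelSet X f (a + (b - a) / (n + 1))) ?_
    (measure_iUnion_null fun n => volume_superlevel_sdiff_levelSet X f _)
  rintro x ⟨⟨hxX, hx⟩, hxM⟩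
  obtain ⟨n, hn⟩ := exists_nat_gt ((b - a) / (f x - a))
  refine mem_iUnion.2 ⟨n, ⟨hxX, ?_⟩, fun h => hxM (mem_biUnion (hlev n) h)⟩
  have hfa : 0 < f x - a := sub_pos.2 hx
  have : (b - a) / (n + 1) ≤ f x - a := by
    rw [div_lt_iff₀ hfa] at hn
    rw [div_le_iff₀ (by positivity)]
    nlinarith
  linarith

/-! ### The algorithm -/

/-- An identified component meets `M_{ρ+ε}^{-δ}`, provided that the points of `M_{ρ+ε}` are close to
this set. -/
theorem exists_mem_subTube_of_mem_identified {X M : Set (E d)} {τ ε δ ρ : ℝ} {L : ℝ → Set (E d)}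
    (hτ : 0 < τ) (hδ : δ < τ / 2) (hcov : ∀ x ∈ M, ∃ y ∈ subTube X δ M, dist x y < τ / 2)
    (hlow : subTube X δ M ⊆ L ρ) (hup : L (ρ + 2 * ε) ⊆ addTube X δ M) {B : Set (E d)}
    (hB : B ∈ identified τ ε L ρ) : ∃ w ∈ subTube X δ M, B = tauClass τ (L ρ) w := by
  obtain ⟨hBc, x, hxB, hxL⟩ := hB
  obtain ⟨y, hy, hxy⟩ := exists_dist_lt_of_mem_addTube hδ (half_pos hτ) (hup hxL)
  obtain ⟨w, hw, hyw⟩ := hcov y hy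
  refine ⟨w, hw, ?_⟩
  rw [eq_tauClass_of_mem hBc hxB]
  rw [eq_tauClass_of_mem hBc hxB] at hxB
  refine (TauConnected.of_dist_lt hxB.2.1 (hlow hw) ?_).tauClass_eq
  linarith [dist_triangle x y w]

theorem exists_repeatLoop {τ ε : ℝ} {L : ℝ → Set (E d)} (n : ℕ) {ρ : ℝ}
    (h : (identified τ ε L (ρ + n * ε)).encard ≠ 1) : ∃ ρ', RepeatLoop τ ε L ρ ρ' := by
  induction n generalizing ρ with
  | zero => exact ⟨_, .exit ρ (by simpa using h)⟩
  | succ n ih =>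
    by_cases h1 : (identified τ ε L ρ).encard = 1
    · obtain ⟨ρ', hρ'⟩ := ih (ρ := ρ + ε) (by convert h using 3; push_cast; ring)
      exact ⟨ρ', .again ρ ρ' h1 hρ'⟩
    · exact ⟨_, .exit ρ h1⟩

/-- An invariant `p` of the loop holds at the last level that the loop examines, where the number
of identified components differs from `1`. -/
theorem RepeatLoop.exists_exit {τ ε ρ ρ' : ℝ} {L : ℝ → Set (E d)} (p : ℝ → Prop)
    (hp : ∀ ρ, p ρ → (identified τ ε L ρ).encard = 1 → p (ρ + ε))
    (h : RepeatLoop τ ε L ρ ρ') (hρ : p ρ) :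
    ∃ ρe, p ρe ∧ ρ' = ρe + ε ∧ (identified τ ε L ρe).encard ≠ 1 := by
  induction h with
  | exit ρ h => exact ⟨ρ, hρ, rfl, h⟩
  | again ρ ρ' h _ ih => exact ih (hp ρ hρ h)

theorem exists_returns {τ ε ρ₀ ρ : ℝ} {L : ℝ → Set (E d)} (h : RepeatLoop τ ε L ρ₀ ρ) :
    ∃ ρout ℬ, Returns τ ε ρ₀ L ρout ℬ := by
  by_cases h1 : 1 < (identified τ ε L (ρ + 2 * ε)).encard
  · exact ⟨_, _, .several ρ h h1⟩
  · exact ⟨_, _, .single ρ h h1⟩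

/-! ### Two clusters -/

theorem Enumerates.mem {A : Fin 2 → Set (E d)} {𝒜 : Set (Set (E d))} (h : Enumerates A 𝒜)
    (i : Fin 2) : A i ∈ 𝒜 := h.2 ▸ mem_range_self i

theorem levelComponent_eq {X : Set (E d)} {f : E d → ℝ} {A : Fin 2 → Set (E d)} {ρ : ℝ} {i : Fin 2}
    {C : Set (E d)} (hA : (A i).Nonempty) (hC : C ∈ components (levelSet X f ρ)) (h : A i ⊆ C) :
    levelComponent X f A ρ i = C := crm_eq (pairwiseDisjoint_components _) hA hC h

/-- At a level with two components, these are the `levelComponent`s. -/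
theorem CanBeClustered.levelComponent_spec {X : Set (E d)} {f : E d → ℝ} {ρs ρss ρ : ℝ}
    {A : Fin 2 → Set (E d)} (h : CanBeClustered X f ρs ρss)
    (hA : Enumerates A (components (levelSet X f ρss))) (hρ : ρ ∈ Icc 0 ρss)
    (h2 : (components (levelSet X f ρ)).encard = 2) :
    Enumerates (levelComponent X f A ρ) (components (levelSet X f ρ)) ∧
      ∀ i, A i ⊆ levelComponent X f A ρ i := by
  obtain ⟨ζ, hζ, hbij⟩ := (h.of_two ρ hρ h2).2
  have heq : levelComponent X f A ρ = ζ ∘ A := funext fun i =>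
    levelComponent_eq (components_nonempty (hA.mem i)) (hζ _ (hA.mem i)).1 (hζ _ (hA.mem i)).2
  rw [heq]
  refine ⟨⟨fun i j hij => hA.1 (hbij.injOn (hA.mem i) (hA.mem j) hij), ?_⟩,
    fun i => (hζ _ (hA.mem i)).2⟩
  rw [range_comp, hA.2, hbij.image_eq]

theorem CanBeClustered.encard_eq_two {X : Set (E d)} {f : E d → ℝ} {ρs ρss ρ : ℝ}
    (h : CanBeClustered X f ρs ρss) (hρ : ρ ∈ Ioc ρs ρss) :
    (components (levelSet X f ρ)).encard = 2 := by
  have hmem : ρ ∈ Icc 0 ρss := ⟨h.nonneg.trans hρ.1.le, hρ.2⟩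
  exact (h.one_or_two ρ hmem).resolve_left fun h1 => hρ.1.not_ge (h.of_one ρ hmem h1)

theorem CanBeClustered.exists_mem_levelComponent {X : Set (E d)} {f : E d → ℝ} {ρs ρss ρ : ℝ}
    {A : Fin 2 → Set (E d)} (h : CanBeClustered X f ρs ρss)
    (hA : Enumerates A (components (levelSet X f ρss))) (hρ : ρ ∈ Icc 0 ρss)
    (h2 : (components (levelSet X f ρ)).encard = 2) {x : E d} (hx : x ∈ levelSet X f ρ) :
    ∃ i, x ∈ levelComponent X f A ρ i := by
  have hmem : connectedComponentIn (levelSet X f ρ) x ∈ components (levelSet X f ρ) :=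
    mem_image_of_mem _ hx
  rw [← (h.levelComponent_spec hA hρ h2).1.2] at hmem
  obtain ⟨i, hi⟩ := hmem
  exact ⟨i, hi ▸ mem_connectedComponentIn hx⟩

theorem setDist_le {A B : Set (E d)} {x y : E d} (hx : x ∈ A) (hy : y ∈ B) :
    setDist A B ≤ dist x y :=
  csInf_le ⟨0, by rintro _ ⟨a, -, b, -, rfl⟩; exact dist_nonneg⟩ (mem_image2_of_mem hx hy)

theorem exists_dist_lt_of_setDist_lt {A B : Set (E d)} (hA : A.Nonempty) (hB : B.Nonempty) {r : ℝ}
    (h : setDist A B < r) : ∃ x ∈ A, ∃ y ∈ B, dist x y < r := by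
  obtain ⟨_, ⟨x, hx, y, hy, rfl⟩, hr⟩ := exists_lt_of_csInf_lt (hA.image2 hB) h
  exact ⟨x, hx, y, hy, hr⟩

/-- The data of the case of two clusters, with `t = c δ^γ`, a point `a i` in each component of
`M_{ρ^{**}}`, and a point `z i` of `M_{ρ^{**}}^{-δ}` close to `a i`. -/
structure TwoClusterSetting (X : Set (E d)) (f : E d → ℝ) (ρs ρss t : ℝ)
    (A : Fin 2 → Set (E d)) (εs ε δ τ ρ₀ : ℝ) (L : ℝ → Set (E d)) (a z : Fin 2 → E d) : Prop where
  clustered : CanBeClustered X f ρs ρss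
  enum : Enumerates A (components (levelSet X f ρss))
  width : εs ≤ (ρss - ρs) / 9
  ε_pos : 0 < ε
  ε_le : ε ≤ εs
  δ_pos : 0 < δ
  δ_le : δ ≤ t
  thick : ∀ ρ ∈ Icc 0 ρss, psiStar X (levelSet X f ρ) δ ≤ ENNReal.ofReal t
  lt_τ : 3 * t < τ
  τ_le : τ ≤ tauStar X f A ρs εs
  start_nonneg : 0 ≤ ρ₀
  start_le : ρ₀ ≤ ρs + εs + 2 * ε
  antitone : AntitoneOn L (Ici 0)
  control : UncertaintyControl X f ε δ ρ₀ L
  a_mem : ∀ i, a i ∈ A i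
  z_mem : ∀ i, z i ∈ subTube X δ (levelSet X f ρss)
  a_z : ∀ i, dist (a i) (z i) < τ / 2

namespace TwoClusterSetting

variable {X : Set (E d)} {f : E d → ℝ} {ρs ρss t : ℝ}
  {A : Fin 2 → Set (E d)} {εs ε δ τ ρ₀ ρ : ℝ} {L : ℝ → Set (E d)} {a z : Fin 2 → E d}

theorem τ_pos (h : TwoClusterSetting X f ρs ρss t A εs ε δ τ ρ₀ L a z) : 0 < τ := by
  linarith [h.lt_τ, h.δ_pos, h.δ_le]

theorem exists_subTube_dist_lt (h : TwoClusterSetting X f ρs ρss t A εs ε δ τ ρ₀ L a z)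
    {r : ℝ} (hr : t < r) (hρ : ρ ∈ Icc 0 ρss) :
    ∀ x ∈ levelSet X f ρ, ∃ y ∈ subTube X δ (levelSet X f ρ), dist x y < r :=
  exists_dist_lt_of_psiStar_le hr (by linarith [h.δ_pos, h.δ_le]) (h.thick ρ hρ)

theorem z_mem_subTube (h : TwoClusterSetting X f ρs ρss t A εs ε δ τ ρ₀ L a z) (hρ : ρ ≤ ρss)
    (i : Fin 2) : z i ∈ subTube X δ (levelSet X f ρ) :=
  subTube_mono (levelSet_antitone X f hρ) (h.z_mem i)

theorem z_mem_L (h : TwoClusterSetting X f ρs ρss t A εs ε δ τ ρ₀ L a z) (h₀ : ρ₀ ≤ ρ)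
    (hρ : ρ + ε ≤ ρss) (i : Fin 2) : z i ∈ L ρ :=
  (h.control ρ h₀).1 (h.z_mem_subTube hρ i)

theorem a_mem_levelSet (h : TwoClusterSetting X f ρs ρss t A εs ε δ τ ρ₀ L a z) (hρ : ρ ≤ ρss)
    (i : Fin 2) : a i ∈ levelSet X f ρ :=
  levelSet_antitone X f hρ (components_subset (h.enum.mem i) (h.a_mem i))

theorem ε_lt (h : TwoClusterSetting X f ρs ρss t A εs ε δ τ ρ₀ L a z) :
    0 < εs ∧ ρs + 9 * εs ≤ ρss ∧ 0 ≤ ρs :=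
  ⟨h.ε_pos.trans_le h.ε_le, by linarith [h.width], h.clustered.nonneg⟩

/-- A point of `M_{ρ+ε}^{-δ}` near a connected subset of `M_{ρ+ε}` that contains `a i` is
`τ`-connected to `z i` in `L_ρ`. -/
theorem tauConnected_z (h : TwoClusterSetting X f ρs ρss t A εs ε δ τ ρ₀ L a z) (h₀ : ρ₀ ≤ ρ)
    (hρ : ρ + ε ≤ ρss) {S : Set (E d)} (hS : IsPreconnected S)
    (hSM : S ⊆ levelSet X f (ρ + ε)) {i : Fin 2} (hi : a i ∈ S) {x y : E d} (hx : x ∈ S)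
    (hy : y ∈ subTube X δ (levelSet X f (ρ + ε))) (hxy : dist x y < τ / 2) :
    TauConnected τ (L ρ) (z i) y := by
  have hmem : ρ + ε ∈ Icc 0 ρss := ⟨by linarith [h.start_nonneg, h.ε_pos], hρ⟩
  have hcov := h.exists_subTube_dist_lt (r := τ / 2) (by linarith [h.lt_τ, h.δ_pos, h.δ_le]) hmem
  exact (tauConnected_of_isPreconnected (by linarith) hS (fun x hx => hcov x (hSM hx)) hi hx
    (h.z_mem_subTube hρ i) hy (h.a_z i) hxy).mono (h.control ρ h₀).1

theorem tauConnected_z_of_encard_eq_one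
    (h : TwoClusterSetting X f ρs ρss t A εs ε δ τ ρ₀ L a z) (h₀ : ρ₀ ≤ ρ)
    (hρ : ρ + ε ≤ ρss) (h1 : (components (levelSet X f (ρ + ε))).encard = 1)
    {y : E d} (hy : y ∈ subTube X δ (levelSet X f (ρ + ε))) (i : Fin 2) :
    TauConnected τ (L ρ) (z i) y :=
  h.tauConnected_z h₀ hρ (isPreconnected_of_encard_components_le_one h1.le) subset_rfl
    (h.a_mem_levelSet hρ i) (subTube_subset hy) hy (by simpa using half_pos h.τ_pos)

theorem identified_eq (h : TwoClusterSetting X f ρs ρss t A εs ε δ τ ρ₀ L a z) (h₀ : ρ₀ ≤ ρ)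
    (hρ : ρ + 3 * ε ≤ ρss) :
    identified τ ε L ρ = range fun i => tauClass τ (L ρ) (z i) := by
  have hε := h.ε_pos
  have hρ' : ρ + ε ≤ ρss := by linarith
  have hmem : ρ + ε ∈ Icc 0 ρss := ⟨by linarith [h.start_nonneg], hρ'⟩
  have hδτ : δ < τ / 2 := by linarith [h.lt_τ, h.δ_pos, h.δ_le]
  have htτ : t < τ / 2 := by linarith [h.lt_τ, h.δ_pos, h.δ_le]
  have hcov := h.exists_subTube_dist_lt htτ hmem
  apply Subset.antisymm
  · intro B hB
    have hup : L (ρ + 2 * ε) ⊆ addTube X δ (levelSet X f (ρ + ε)) := by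
      have := (h.control (ρ + 2 * ε) (by linarith)).2
      rwa [show ρ + 2 * ε - ε = ρ + ε by ring] at this
    obtain ⟨w, hw, rfl⟩ := exists_mem_subTube_of_mem_identified h.τ_pos hδτ hcov
      (h.control ρ h₀).1 hup hB
    rcases h.clustered.one_or_two _ hmem with h1 | h2
    · exact ⟨0, (h.tauConnected_z_of_encard_eq_one h₀ hρ' h1 hw 0).tauClass_eq⟩
    · obtain ⟨i, hi⟩ := h.clustered.exists_mem_levelComponent h.enum hmem h2 (subTube_subset hw)
      obtain ⟨henum, hA⟩ := h.clustered.levelComponent_spec h.enum hmem h2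
      exact ⟨i, (h.tauConnected_z h₀ hρ' (components_isPreconnected (henum.mem i))
        (components_subset (henum.mem i)) (hA i (h.a_mem i)) hi hw
        (by simpa using half_pos h.τ_pos)).tauClass_eq⟩
  · rintro _ ⟨i, rfl⟩
    have hz : z i ∈ L ρ := h.z_mem_L h₀ hρ' i
    exact ⟨tauClass_mem_tauComponents hz, z i, mem_tauClass_self hz,
      h.z_mem_L (by linarith) (by linarith) i⟩

theorem encard_identified_eq_one_iff (h : TwoClusterSetting X f ρs ρss t A εs ε δ τ ρ₀ L a z)
    (h₀ : ρ₀ ≤ ρ) (hρ : ρ + 3 * ε ≤ ρss) :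
    (identified τ ε L ρ).encard = 1 ↔ TauConnected τ (L ρ) (z 0) (z 1) := by
  rw [h.identified_eq h₀ hρ, encard_eq_one]
  have hz : ∀ i, z i ∈ L ρ := h.z_mem_L h₀ (by linarith [h.ε_pos])
  constructor
  · rintro ⟨B, hB⟩
    have h0 : tauClass τ (L ρ) (z 0) = B := by
      simpa [hB] using mem_range_self (f := fun i => tauClass τ (L ρ) (z i)) 0
    have h1 : tauClass τ (L ρ) (z 1) = B := by
      simpa [hB] using mem_range_self (f := fun i => tauClass τ (L ρ) (z i)) 1
    have := mem_tauClass_self (τ := τ) (hz 1)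
    rw [h1, ← h0] at this
    exact this
  · intro hc
    refine ⟨tauClass τ (L ρ) (z 0), ?_⟩
    ext B
    simp [Fin.exists_fin_two, ← hc.tauClass_eq, eq_comm]

/-- `z 0` and `z 1` are separated in `L_ρ` at all levels `ρ ≥ ρ^* + ε^* + ε`: a chain in `L_ρ` that
starts near the component of `a 0` in `M_{ρ^*+ε^*}` cannot jump over to the other component. -/
theorem not_tauConnected (h : TwoClusterSetting X f ρs ρss t A εs ε δ τ ρ₀ L a z) (h₀ : ρ₀ ≤ ρ)
    (hρ : ρs + εs ≤ ρ - ε) : ¬ TauConnected τ (L ρ) (z 0) (z 1) := by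
  intro hc
  obtain ⟨hεs, hw, hρs⟩ := h.ε_lt
  have hτ := h.τ_pos
  have hδτ : δ < τ / 2 := by linarith [h.lt_τ, h.δ_pos, h.δ_le]
  have hmem' : ρs + εs ∈ Ioc ρs ρss := ⟨by linarith, by linarith⟩
  have hmem : ρs + εs ∈ Icc 0 ρss := ⟨by linarith, hmem'.2⟩
  have h2 := h.clustered.encard_eq_two hmem'
  obtain ⟨-, hA⟩ := h.clustered.levelComponent_spec h.enum hmem h2
  set D := levelComponent X f A (ρs + εs) with hD
  have hsep : ∀ x ∈ D 0, ∀ y ∈ D 1, 3 * τ ≤ dist x y := fun x hx y hy => by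
    have h1 := setDist_le hx hy
    have h3 := h.τ_le
    simp only [tauStar, ← hD] at h3
    linarith
  have hnear : ∀ v ∈ L ρ, ∃ i, ∃ y ∈ D i, dist v y < τ / 2 := fun v hv => by
    obtain ⟨y, hy, hvy⟩ := exists_dist_lt_of_mem_addTube hδτ (by linarith)
      (addTube_mono (levelSet_antitone X f hρ) ((h.control ρ h₀).2 hv))
    obtain ⟨i, hi⟩ := h.clustered.exists_mem_levelComponent h.enum hmem h2 hy
    exact ⟨i, y, hi, hvy⟩
  have key : ∀ w, Relation.ReflTransGen (fun u v => u ∈ L ρ ∧ v ∈ L ρ ∧ dist u v < τ) (z 0) w →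
      ∃ x ∈ D 0, dist w x < τ / 2 := by
    intro w hw
    induction hw with
    | refl => exact ⟨a 0, hA 0 (h.a_mem 0), by rw [dist_comm]; exact h.a_z 0⟩
    | @tail u v _ huv ih =>
      obtain ⟨x, hx, hux⟩ := ih
      obtain ⟨i, y, hy, hvy⟩ := hnear v huv.2.1
      fin_cases i
      · exact ⟨y, hy, hvy⟩
      · have h1 := hsep x hx y hy
        have h4 := dist_triangle4 x u v y
        rw [dist_comm x u] at h4
        linarith [huv.2.2]
  obtain ⟨x, hx, hxz⟩ := key (z 1) hc.2.2
  have h1 := hsep x hx (a 1) (hA 1 (h.a_mem 1))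
  have h4 := dist_triangle x (z 1) (a 1)
  rw [dist_comm x (z 1), dist_comm (z 1) (a 1)] at h4
  linarith [h.a_z 1]

theorem exists_returns (h : TwoClusterSetting X f ρs ρss t A εs ε δ τ ρ₀ L a z) :
    ∃ ρout ℬ, Returns τ ε ρ₀ L ρout ℬ := by
  obtain ⟨hεs, hw, hρs⟩ := h.ε_lt
  have hε := h.ε_pos
  have hle := h.ε_le
  have hst := h.start_le
  -- The first level `ρ₀ + nε` in `[ρ^* + ε^* + ε, ∞)`.
  set n := ⌈(ρs + εs + ε - ρ₀) / ε⌉₊ with hn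
  have hlow : ρs + εs + ε ≤ ρ₀ + n * ε := by
    have := Nat.le_ceil ((ρs + εs + ε - ρ₀) / ε)
    rw [div_le_iff₀ hε] at this
    linarith
  have hup : ρ₀ + n * ε ≤ ρs + εs + 2 * ε := by
    rcases le_or_gt ((ρs + εs + ε - ρ₀) / ε) 0 with h0 | h0
    · rw [hn, Nat.ceil_eq_zero.2 h0]
      simpa using hst
    · have := Nat.ceil_lt_add_one h0.le
      rw [← sub_lt_iff_lt_add, lt_div_iff₀ hε] at this
      linarith
  have h₀ : ρ₀ ≤ ρ₀ + n * ε := le_add_of_nonneg_right (by positivity)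
  obtain ⟨ρ', hρ'⟩ := exists_repeatLoop n (τ := τ) (L := L) fun h1 =>
    h.not_tauConnected h₀ (by linarith)
      ((h.encard_identified_eq_one_iff h₀ (by linarith)).1 h1)
  exact LevelSetClustering.exists_returns hρ'

/-- The outcome of a run: the returned level, at which `z 0` and `z 1` are separated, and their
`τ`-classes. -/
theorem of_returns (h : TwoClusterSetting X f ρs ρss t A εs ε δ τ ρ₀ L a z) {ρout : ℝ}
    {ℬ : Set (Set (E d))} (hret : Returns τ ε ρ₀ L ρout ℬ) :
    ρ₀ ≤ ρout ∧ ρout ∈ Icc (ρs + 2 * ε) (ρs + εs + 5 * ε) ∧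
      ¬ TauConnected τ (L ρout) (z 0) (z 1) ∧
      ℬ = range fun i => tauClass τ (L ρout) (z i) := by
  obtain ⟨hεs, hw, hρs⟩ := h.ε_lt
  have hε := h.ε_pos
  have hle := h.ε_le
  have hstep : ∀ ρ, (ρ₀ ≤ ρ ∧ ρ ≤ ρs + εs + 2 * ε) → (identified τ ε L ρ).encard = 1 →
      (ρ₀ ≤ ρ + ε ∧ ρ + ε ≤ ρs + εs + 2 * ε) := fun ρ hρ h1 => by
    refine ⟨by linarith, ?_⟩
    by_contra! hlt
    exact h.not_tauConnected hρ.1 (by linarith)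
      ((h.encard_identified_eq_one_iff hρ.1 (by linarith)).1 h1)
  have hexit : ∀ ρ, RepeatLoop τ ε L ρ₀ ρ → ρ₀ ≤ ρ + 2 * ε ∧
      ρ + 2 * ε ∈ Icc (ρs + 2 * ε) (ρs + εs + 5 * ε) ∧
      ¬ TauConnected τ (L (ρ + 2 * ε)) (z 0) (z 1) := fun ρ hloop => by
    obtain ⟨ρe, ⟨hρ₀, hρe⟩, rfl, hne⟩ := hloop.exists_exit _ hstep ⟨le_rfl, h.start_le⟩
    have hns : ¬ TauConnected τ (L ρe) (z 0) (z 1) := fun hc =>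
      hne ((h.encard_identified_eq_one_iff hρ₀ (by linarith)).2 hc)
    have hpos := h.start_nonneg
    refine ⟨by linarith, ⟨?_, by linarith⟩, fun hc => hns (hc.mono ?_)⟩
    · have hmem : ρe + ε ∈ Icc 0 ρss := ⟨by linarith, by linarith⟩
      rcases h.clustered.one_or_two _ hmem with h1 | h2
      · exact absurd (h.tauConnected_z_of_encard_eq_one hρ₀ hmem.2 h1
          (h.z_mem_subTube hmem.2 1) 0) hns
      · linarith [(h.clustered.of_two _ hmem h2).1]
    · exact h.antitone (hpos.trans hρ₀) (show (0 : ℝ) ≤ ρe + ε + 2 * ε by linarith) (by linarith)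
  cases hret with
  | several ρ hloop h1 =>
    obtain ⟨h₀, hI, hns⟩ := hexit ρ hloop
    exact ⟨h₀, hI, hns, h.identified_eq h₀ (by linarith [hI.2])⟩
  | single ρ hloop h1 =>
    exfalso
    obtain ⟨h₀, hI, hns⟩ := hexit ρ hloop
    have hne : (identified τ ε L (ρ + 2 * ε)).Nonempty := by
      rw [h.identified_eq h₀ (by linarith [hI.2])]
      exact range_nonempty _
    refine hns ((h.encard_identified_eq_one_iff h₀ (by linarith [hI.2])).1 ?_)
    exact le_antisymm (not_lt.1 h1) (one_le_encard_iff_nonempty.2 hne)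

/-- Two points of the different components of `M_{ρ+ε}` at distance at most `τ - 3t` would yield two
points of `M_{ρ+ε}^{-δ}` at distance less than `τ`, which join `z 0` to `z 1` in `L_ρ`. -/
theorem lt_tauStar (h : TwoClusterSetting X f ρs ρss t A εs ε δ τ ρ₀ L a z) (h₀ : ρ₀ ≤ ρ)
    (hρ : ρ + ε ∈ Ioc ρs ρss) (hns : ¬ TauConnected τ (L ρ) (z 0) (z 1)) :
    τ - 3 * t < 3 * tauStar X f A ρs (ρ - ρs + ε) := by
  have ht : 0 < t := h.δ_pos.trans_le h.δ_le
  have hmem : ρ + ε ∈ Icc 0 ρss := ⟨h.clustered.nonneg.trans hρ.1.le, hρ.2⟩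
  obtain ⟨henum, hA⟩ :=
    h.clustered.levelComponent_spec h.enum hmem (h.clustered.encard_eq_two hρ)
  rw [tauStar, show ρs + (ρ - ρs + ε) = ρ + ε by ring]
  by_contra! hle
  obtain ⟨x, hx, x', hx', hxx⟩ := exists_dist_lt_of_setDist_lt
    (components_nonempty (henum.mem 0)) (components_nonempty (henum.mem 1))
    (r := τ - 3 * t + t / 3) (by linarith)
  have hcov := h.exists_subTube_dist_lt (r := 4 / 3 * t) (by linarith) hmem
  obtain ⟨y, hy, hxy⟩ := hcov x (components_subset (henum.mem 0) hx)
  obtain ⟨y', hy', hxy'⟩ := hcov x' (components_subset (henum.mem 1) hx')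
  have hlt := h.lt_τ
  have c0 := h.tauConnected_z h₀ hρ.2 (components_isPreconnected (henum.mem 0))
    (components_subset (henum.mem 0)) (hA 0 (h.a_mem 0)) hx hy (by linarith)
  have c1 := h.tauConnected_z h₀ hρ.2 (components_isPreconnected (henum.mem 1))
    (components_subset (henum.mem 1)) (hA 1 (h.a_mem 1)) hx' hy' (by linarith)
  refine hns (c0.trans ((TauConnected.of_dist_lt c0.2.1 c1.2.1 ?_).trans c1.symm))
  have h4 := dist_triangle4 y x x' y'
  rw [dist_comm y x] at h4
  linarith

theorem subTube_levelComponent_subset (h : TwoClusterSetting X f ρs ρss t A εs ε δ τ ρ₀ L a z)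
    (h₀ : ρ₀ ≤ ρ) (hρ : ρ + ε ∈ Ioc ρs ρss) (i : Fin 2) :
    subTube X δ (levelComponent X f A (ρ + ε) i) ⊆ tauClass τ (L ρ) (z i) := by
  have hmem : ρ + ε ∈ Icc 0 ρss := ⟨h.clustered.nonneg.trans hρ.1.le, hρ.2⟩
  obtain ⟨henum, hA⟩ :=
    h.clustered.levelComponent_spec h.enum hmem (h.clustered.encard_eq_two hρ)
  intro y hy
  exact h.tauConnected_z h₀ hρ.2 (components_isPreconnected (henum.mem i))
    (components_subset (henum.mem i)) (hA i (h.a_mem i)) (subTube_subset hy)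
    (subTube_mono (components_subset (henum.mem i)) hy) (by simpa using half_pos h.τ_pos)

end TwoClusterSetting

/-- Up to a null set, `{f > ρ^*}` is covered by the two clusters. -/
theorem CanBeClustered.volume_sdiff_cluster {X : Set (E d)} {f : E d → ℝ} {ρs ρss : ℝ}
    {A : Fin 2 → Set (E d)} (h : CanBeClustered X f ρs ρss)
    (hA : Enumerates A (components (levelSet X f ρss))) :
    volume ({x | x ∈ X ∧ ρs < f x} \
      (cluster X f A ρs ρss 0 ∪ cluster X f A ρs ρss 1)) = 0 := by
  refine measure_mono_null (sdiff_subset_sdiff_right ?_)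
    (volume_strict_superlevel_sdiff_iUnion_levelSet X f h.lt)
  refine iUnion₂_subset fun ρ hρ x hx => ?_
  obtain ⟨i, hi⟩ := h.exists_mem_levelComponent hA ⟨h.nonneg.trans hρ.1.le, hρ.2⟩
    (h.encard_eq_two hρ) hx
  have hi' : x ∈ cluster X f A ρs ρss i := mem_biUnion hρ hi
  fin_cases i
  · exact Or.inl hi'
  · exact Or.inr hi'

/-- Lebesgue outer measure is additive on subsets of distinct `τ`-classes, which are separated by a
positive distance. -/
theorem volume_add_le_of_tauClass {τ : ℝ} (hτ : 0 < τ) {S : Set (E d)} {x y : E d}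
    (hns : ¬ TauConnected τ S x y) {G H T : Set (E d)} (hG : G ⊆ tauClass τ S x)
    (hH : H ⊆ tauClass τ S y) (hGT : G ⊆ T) (hHT : H ⊆ T) :
    volume G + volume H ≤ volume T := by
  have hU : MeasurableSet (Metric.thickening τ G) := Metric.isOpen_thickening.measurableSet
  rw [← measure_inter_add_sdiff T hU]
  refine add_le_add (measure_mono (subset_inter hGT (Metric.self_subset_thickening hτ G)))
    (measure_mono fun w hw => ⟨hHT hw, fun hwG => ?_⟩)
  obtain ⟨v, hv, hwv⟩ := Metric.mem_thickening_iff.1 hwG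
  have hv' : TauConnected τ S x v := hG hv
  have hw' : TauConnected τ S y w := hH hw
  rw [dist_comm] at hwv
  exact hns (hv'.trans ((TauConnected.of_dist_lt hv'.2.1 hw'.2.1 hwv).trans hw'.symm))

/-- The estimate for two disjoint sets `B₀, B₁` with inner approximations `I₀, I₁` of the targets
`S₀, S₁`. A point of `B₀ \ S₀` either lies outside both targets or lies in `S₁ \ B₁`; thus each
`S_i \ I_i` is counted twice. -/
theorem measure_symmDiff_add_le {α : Type*} [MeasurableSpace α] {μ : Measure α}
    {B₀ B₁ S₀ S₁ I₀ I₁ : Set α} (hB : Disjoint B₀ B₁) (h₀ : I₀ ⊆ B₀) (h₁ : I₁ ⊆ B₁) :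
    μ (symmDiff B₀ S₀) + μ (symmDiff B₁ S₁) ≤ 2 * (μ (S₀ \ I₀) + μ (S₁ \ I₁)) +
      (μ (B₀ \ (S₀ ∪ S₁)) + μ (B₁ \ (S₀ ∪ S₁))) := by
  have e₀ : symmDiff B₀ S₀ ⊆ (S₀ \ I₀) ∪ (S₁ \ I₁) ∪ (B₀ \ (S₀ ∪ S₁)) := by
    rintro x (⟨hx, hxS⟩ | ⟨hxS, hx⟩)
    · by_cases hx1 : x ∈ S₁
      · exact Or.inl (Or.inr ⟨hx1, fun hI => disjoint_left.1 hB hx (h₁ hI)⟩)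
      · exact Or.inr ⟨hx, by simp [hxS, hx1]⟩
    · exact Or.inl (Or.inl ⟨hxS, fun hI => hx (h₀ hI)⟩)
  have e₁ : symmDiff B₁ S₁ ⊆ (S₀ \ I₀) ∪ (S₁ \ I₁) ∪ (B₁ \ (S₀ ∪ S₁)) := by
    rintro x (⟨hx, hxS⟩ | ⟨hxS, hx⟩)
    · by_cases hx0 : x ∈ S₀
      · exact Or.inl (Or.inl ⟨hx0, fun hI => disjoint_left.1 hB (h₀ hI) hx⟩)
      · exact Or.inr ⟨hx, by simp [hxS, hx0]⟩
    · exact Or.inl (Or.inr ⟨hxS, fun hI => hx (h₁ hI)⟩)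
  have m₀ := ((measure_mono e₀).trans (measure_union_le (μ := μ) _ _)).trans
    (add_le_add (measure_union_le _ _) le_rfl)
  have m₁ := ((measure_mono e₁).trans (measure_union_le (μ := μ) _ _)).trans
    (add_le_add (measure_union_le _ _) le_rfl)
  refine (add_le_add m₀ m₁).trans (le_of_eq ?_)
  ring

/-- The measure estimate at a level `ρ` at which `z 0` and `z 1` are separated. -/
theorem TwoClusterSetting.volume_symmDiff_le {X : Set (E d)} {f : E d → ℝ} {ρs ρss t : ℝ}
    {A : Fin 2 → Set (E d)} {εs ε δ τ ρ₀ ρ : ℝ} {L : ℝ → Set (E d)} {a z : Fin 2 → E d}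
    (h : TwoClusterSetting X f ρs ρss t A εs ε δ τ ρ₀ L a z) (h₀ : ρ₀ ≤ ρ)
    (hρ : ρ + ε ∈ Ioc ρs ρss) (hns : ¬ TauConnected τ (L ρ) (z 0) (z 1)) :
    ∑ i, volume (symmDiff (tauClass τ (L ρ) (z i)) (cluster X f A ρs ρss i)) ≤
      2 * ∑ i, volume (cluster X f A ρs ρss i \
          subTube X δ (levelComponent X f A (ρ + ε) i)) +
        volume (addTube X δ (levelSet X f (ρ - ε)) \ {x | x ∈ X ∧ ρs < f x}) := by
  have hdisj : Disjoint (tauClass τ (L ρ) (z 0)) (tauClass τ (L ρ) (z 1)) :=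
    disjoint_left.2 fun w hw hw' => hns (TauConnected.trans hw (TauConnected.symm hw'))
  rw [Fin.sum_univ_two, Fin.sum_univ_two]
  refine (measure_symmDiff_add_le hdisj (h.subTube_levelComponent_subset h₀ hρ 0)
    (h.subTube_levelComponent_subset h₀ hρ 1)).trans (add_le_add le_rfl ?_)
  set S := cluster X f A ρs ρss 0 ∪ cluster X f A ρs ρss 1
  have hsub : ∀ i, tauClass τ (L ρ) (z i) \ S ⊆ addTube X δ (levelSet X f (ρ - ε)) \ S :=
    fun i => sdiff_subset_sdiff_left (tauClass_subset.trans (h.control ρ h₀).2)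
  refine (volume_add_le_of_tauClass h.τ_pos hns sdiff_subset sdiff_subset
    (hsub 0) (hsub 1)).trans ?_
  have hnull := h.clustered.volume_sdiff_cluster h.enum
  refine (measure_mono (t := (addTube X δ (levelSet X f (ρ - ε)) \ {x | x ∈ X ∧ ρs < f x}) ∪
    ({x | x ∈ X ∧ ρs < f x} \ S)) ?_).trans ((measure_union_le _ _).trans ?_)
  · rintro x ⟨hx, hxS⟩
    by_cases hf : x ∈ {x | x ∈ X ∧ ρs < f x}
    · exact Or.inr ⟨hf, hxS⟩
    · exact Or.inl ⟨hx, hf⟩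
  · rw [hnull, add_zero]

/-! ### A single cluster -/

theorem le_mul_rpow {c γ δ δt : ℝ} (hγ : γ ∈ Ioc (0 : ℝ) 1) (hc : 1 ≤ c)
    (hδt : δt ∈ Ioc (0 : ℝ) 1) (hδ : δ ∈ Ioc 0 δt) : δ ≤ c * δ ^ γ := by
  have h1 : δ ^ (1 : ℝ) ≤ δ ^ γ :=
    Real.rpow_le_rpow_of_exponent_ge hδ.1 (hδ.2.trans hδt.2) hγ.2
  rw [Real.rpow_one] at h1
  exact h1.trans (le_mul_of_one_le_left (hδ.1.le.trans h1) hc)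

theorem encard_identified_le_one_of_oneCluster {X : Set (E d)} {P : Measure (E d)}
    {f : E d → ℝ} {ρl γ c δt ε δ τ ρ₀ ρ : ℝ} {L : ℝ → Set (E d)}
    (h : OneClusterAssumption X P f ρl γ c δt) (hε : 0 < ε) (hδ : δ ∈ Ioc 0 δt)
    (hτ : 2 * c * δ ^ γ < τ) (hl : ρl ≤ ρ₀) (hL : IsDecreasingFamily X L)
    (hU : UncertaintyControl X f ε δ ρ₀ L) (hρ : ρ₀ ≤ ρ) :
    (identified τ ε L ρ).encard ≤ 1 := by
  have hδt : δ ≤ c * δ ^ γ := le_mul_rpow h.order_mem h.one_le h.delta_mem hδ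
  have hδ0 : 0 < δ := hδ.1
  have hτ' : c * δ ^ γ < τ / 2 := by linarith
  have hρl : ρl ≤ ρ + ε := by linarith
  have hlow := (hU ρ hρ).1
  have hup : L (ρ + 2 * ε) ⊆ addTube X δ (levelSet X f (ρ + ε)) := by
    have := (hU (ρ + 2 * ε) (by linarith)).2
    rwa [show ρ + 2 * ε - ε = ρ + ε by ring] at this
  rw [encard_le_one_iff]
  intro B B' hB hB'
  rcases (subTube X δ (levelSet X f (ρ + ε))).eq_empty_or_nonempty with hemp | hne
  · -- The tube around `M_{ρ+ε}` is so small that `L_{ρ+2ε}` is `τ`-connected in itself.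
    obtain ⟨hBc, x, hxB, hxL⟩ := hB
    obtain ⟨hBc', x', hxB', hxL'⟩ := hB'
    have h1 := h.tube_connected _ hρl δ hδ hemp _ ⟨x, hxL⟩ hup τ hτ
    have heq := encard_le_one_iff.1 h1.le _ _ (tauClass_mem_tauComponents hxL)
      (tauClass_mem_tauComponents hxL')
    have hx'mem : TauConnected τ (L (ρ + 2 * ε)) x x' := by
      have := mem_tauClass_self (τ := τ) hxL'
      rwa [← heq] at this
    have hpos : 0 ≤ ρ := h.level_nonneg.trans (hl.trans hρ)
    have hsub : L (ρ + 2 * ε) ⊆ L ρ :=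
      hL.antitone hpos (show (0 : ℝ) ≤ ρ + 2 * ε by linarith) (by linarith)
    rw [eq_tauClass_of_mem hBc hxB, eq_tauClass_of_mem hBc' hxB']
    exact (hx'mem.mono hsub).tauClass_eq
  · have hcov := exists_dist_lt_of_psiStar_le hτ' (by linarith) (h.thick _ hρl δ hδ hne)
    have hpre := isPreconnected_of_encard_components_le_one (h.connected _ hρl)
    obtain ⟨w, hw, rfl⟩ := exists_mem_subTube_of_mem_identified (by linarith) (by linarith)
      hcov hlow hup hB
    obtain ⟨w', hw', rfl⟩ := exists_mem_subTube_of_mem_identified (by linarith) (by linarith)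
      hcov hlow hup hB'
    have hself : ∀ v : E d, dist v v < τ / 2 := fun v => by rw [dist_self]; linarith
    exact ((tauConnected_of_isPreconnected (by linarith) hpre hcov (subTube_subset hw)
      (subTube_subset hw') hw hw' (hself w) (hself w')).mono hlow).tauClass_eq

theorem exists_returns_of_oneCluster {X : Set (E d)} {P : Measure (E d)}
    {f : E d → ℝ} {ρl γ c δt ε δ τ ρ₀ : ℝ} {L : ℝ → Set (E d)}
    (h : OneClusterAssumption X P f ρl γ c δt) (hε : 0 < ε)
    (hU : UncertaintyControl X f ε δ ρ₀ L) :
    ∃ ρout ℬ, Returns τ ε ρ₀ L ρout ℬ := by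
  obtain ⟨C, hC⟩ := h.density.bounded
  obtain ⟨n, hn⟩ := exists_nat_gt ((C - ρ₀) / ε)
  rw [div_lt_iff₀ hε] at hn
  have hn0 : (0 : ℝ) ≤ n * ε := by positivity
  have hempty : L (ρ₀ + n * ε + 2 * ε) = ∅ := by
    have h1 := (hU (ρ₀ + n * ε + 2 * ε) (by linarith)).2
    rwa [levelSet_eq_empty hC (by linarith), addTube_empty, subset_empty_iff] at h1
  obtain ⟨ρ', hρ'⟩ := exists_repeatLoop (τ := τ) (ε := ε) (L := L) (ρ := ρ₀) n (by
    have : identified τ ε L (ρ₀ + n * ε) = ∅ := by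
      ext B
      simp [identified, hempty]
    simp [this])
  exact exists_returns hρ'

end LevelSetClustering

theorem mainTheorem7 (d : ℕ) (X : Set (LevelSetClustering.E d))
    (P : Measure (LevelSetClustering.E d)) (f : LevelSetClustering.E d → ℝ) :
    (∀ (ρs ρss γ c δt : ℝ) (A : Fin 2 → Set (LevelSetClustering.E d))
        (εs ε δ τ ρ₀ : ℝ) (L : ℝ → Set (LevelSetClustering.E d)),
      LevelSetClustering.TwoClusterAssumption X P f ρs ρss γ c δt →
      LevelSetClustering.Enumerates A
        (LevelSetClustering.components (LevelSetClustering.levelSet X f ρss)) →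
      εs ≤ (ρss - ρs) / 9 →
      ε ∈ Ioc 0 εs →
      δ ∈ Ioc 0 δt →
      τ ∈ Ioc (LevelSetClustering.thickness c γ δ) (LevelSetClustering.tauStar X f A ρs εs) →
      0 ≤ ρ₀ →
      ρ₀ ≤ ρs + εs + 2 * ε →
      LevelSetClustering.IsDecreasingFamily X L →
      LevelSetClustering.UncertaintyControl X f ε δ ρ₀ L →
      (∃ ρout ℬ, LevelSetClustering.Returns τ ε ρ₀ L ρout ℬ) ∧
      ∀ ρout ℬ, LevelSetClustering.Returns τ ε ρ₀ L ρout ℬ →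
        ρout ∈ Icc (ρs + 2 * ε) (ρs + εs + 5 * ε) ∧
        τ - LevelSetClustering.thickness c γ δ
          < 3 * LevelSetClustering.tauStar X f A ρs (ρout - ρs + ε) ∧
        ∃ B A' : Fin 2 → Set (LevelSetClustering.E d),
          LevelSetClustering.Enumerates B ℬ ∧
          LevelSetClustering.Enumerates A'
            (LevelSetClustering.components (LevelSetClustering.levelSet X f (ρout + ε))) ∧
          (∀ i, A' i ⊆ LevelSetClustering.cluster X f A ρs ρss i) ∧
          ∑ i, volume (symmDiff (B i) (LevelSetClustering.cluster X f A ρs ρss i))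
            ≤ 2 * ∑ i, volume (LevelSetClustering.cluster X f A ρs ρss i \
                  LevelSetClustering.subTube X δ (A' i))
              + volume (LevelSetClustering.addTube X δ
                  (LevelSetClustering.levelSet X f (ρout - ε)) \ {x | x ∈ X ∧ ρs < f x})) ∧
    (∀ (ρl γ c δt ε δ τ ρ₀ : ℝ) (L : ℝ → Set (LevelSetClustering.E d)),
      LevelSetClustering.OneClusterAssumption X P f ρl γ c δt →
      0 < ε →
      δ ∈ Ioc 0 δt →
      2 * c * δ ^ γ < τ →
      ρl ≤ ρ₀ →
      LevelSetClustering.IsDecreasingFamily X L →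
      LevelSetClustering.UncertaintyControl X f ε δ ρ₀ L →
      (∃ ρout ℬ, LevelSetClustering.Returns τ ε ρ₀ L ρout ℬ) ∧
      (∀ ρout ℬ, LevelSetClustering.Returns τ ε ρ₀ L ρout ℬ → ρout = ρ₀ ∧ ℬ = {L ρ₀}) ∧
      volume (symmDiff (L ρ₀) (LevelSetClustering.upperLevelSet X f ρl))
        ≤ volume (LevelSetClustering.addTube X δ (LevelSetClustering.levelSet X f (ρ₀ - ε)) \
              LevelSetClustering.upperLevelSet X f ρl)
          + volume (LevelSetClustering.upperLevelSet X f ρl \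
              LevelSetClustering.subTube X δ (LevelSetClustering.levelSet X f (ρ₀ + ε)))) := by
  open LevelSetClustering in
  refine ⟨?_, ?_⟩
  · intro ρs ρss γ c δt A εs ε δ τ ρ₀ L hass hA hεs hε hδ hτ h0 hst hL hU
    have hth := hass.thick
    have ht : 3 * (c * δ ^ γ) = thickness c γ δ := by rw [thickness]; ring
    have hδle : δ ≤ c * δ ^ γ := le_mul_rpow hth.order_mem hth.one_le hth.delta_mem hδ
    have hδ0 : 0 < δ := hδ.1
    have hτ1 := hτ.1
    choose a ha using fun i => components_nonempty (hA.mem i)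
    choose z hz haz using fun i => exists_dist_lt_of_psiStar_le (r := τ / 2) (by linarith)
      (by linarith) (hth.thick δ hδ ρss ⟨hth.level_pos.le, le_rfl⟩) (a i)
      (components_subset (hA.mem i) (ha i))
    have h : TwoClusterSetting X f ρs ρss (c * δ ^ γ) A εs ε δ τ ρ₀ L a z :=
      { clustered := hass.clustered, enum := hA, width := hεs, ε_pos := hε.1, ε_le := hε.2,
        δ_pos := hδ0, δ_le := hδle, thick := hth.thick δ hδ, lt_τ := by rwa [ht],
        τ_le := hτ.2, start_nonneg := h0, start_le := hst, antitone := hL.antitone,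
        control := hU, a_mem := ha, z_mem := hz, a_z := haz }
    refine ⟨h.exists_returns, fun ρout ℬ hret => ?_⟩
    obtain ⟨h₀, hI, hns, rfl⟩ := h.of_returns hret
    obtain ⟨hεs0, hw, hρs⟩ := h.ε_lt
    have hε0 : 0 < ε := hε.1
    have hεle : ε ≤ εs := hε.2
    have hmem : ρout + ε ∈ Ioc ρs ρss := ⟨by linarith [hI.1], by linarith [hI.2]⟩
    refine ⟨hI, ht ▸ h.lt_tauStar h₀ hmem hns, fun i => tauClass τ (L ρout) (z i),
      levelComponent X f A (ρout + ε), ⟨?_, rfl⟩,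
      (hass.clustered.levelComponent_spec hA ⟨by linarith [hmem.1], hmem.2⟩
        (hass.clustered.encard_eq_two hmem)).1,
      fun i => subset_biUnion_of_mem (u := fun ρ => levelComponent X f A ρ i) hmem,
      h.volume_symmDiff_le h₀ hmem hns⟩
    have hne : tauClass τ (L ρout) (z 0) ≠ tauClass τ (L ρout) (z 1) := fun heq => by
      have := mem_tauClass_self (τ := τ) (h.z_mem_L h₀ hmem.2 1)
      rw [← heq] at this
      exact hns this
    intro i j hij
    fin_cases i <;> fin_cases j
    · rfl
    · exact absurd hij hne
    · exact absurd hij.symm hne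
    · rfl
  · intro ρl γ c δt ε δ τ ρ₀ L hass hε hδ hτ hl hL hU
    refine ⟨exists_returns_of_oneCluster hass hε hU, fun ρout ℬ hret => ?_, ?_⟩
    · cases hret with
      | several ρ hloop h1 =>
        obtain ⟨ρe, hρe, rfl, -⟩ := hloop.exists_exit (fun ρ => ρ₀ ≤ ρ)
          (fun ρ hρ _ => by linarith) le_rfl
        exact absurd h1 (encard_identified_le_one_of_oneCluster hass hε hδ hτ hl hL hU
          (by linarith)).not_gt
      | single ρ hloop h1 => exact ⟨rfl, rfl⟩
    · obtain ⟨hlow, hup⟩ := hU ρ₀ le_rfl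
      exact (measure_union_le _ _).trans (add_le_add
        (measure_mono (sdiff_subset_sdiff_left hup)) (measure_mono (sdiff_subset_sdiff_right hlow)))
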